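/- Let $f:\mathbb R^n\to\mathbb R$ be twice continuously differentiable and strongly convex with modulus $\mu_f\ge 0$ (merely convex if $\mu_f=0$), with $L_f$-Lipschitz gradient, $L_f\ge 0$. Let $g:\mathbb R^n\to\mathbb R\cup\{+\infty\}$ be proper, lower semicontinuous and convex, and let $X_\star$ be the set of minimizers of $F=f+g$ over $\mathbb R^n$. For $\gamma\in(0,1/L_f)$ (with $1/0=+\infty$) let $$\mathrm{prox}_{\gamma g}(x)=\operatorname*{argmin}_u\Big\{g(u)+\tfrac1{2\gamma}\|u-x\|^2\Big\},\qquad g^\gamma(x)=\inf_u\Big\{g(u)+\tfrac1{2\gamma}\|u-x\|^2\Big\},$$ and let the forward-backward envelope of $F$ be $$F_\gamma(x)=f(x)-\tfrac\gamma2\|\nabla f(x)\|^2+g^\gamma\big(x-\gamma\nabla f(x)\big).$$ For a locally Lipschitz map $G:\mathbb R^n\to\mathbb R^n$, let $\partial_C G(x)$ be its Clarke generalized Jacobian, i.e. the convex hull of all limits $\lim_k \nabla G(y^k)$ with $y^k\to x$ and $G$ differentiable at every $y^k$. Put $$\hat\partial^2F_\gamma(x)=\big\{\gamma^{-1}(I-\gamma\nabla^2f(x))\big(I-P(I-\gamma\nabla^2f(x))\big)\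 :\ P\in\partial_C(\mathrm{prox}_{\gamma g})(x-\gamma\nabla f(x))\big\}.$$ Let $\sigma\in(0,1/2)$, $\bar\eta\in(0,1)$, $\zeta\in(0,1)$, $\rho\in(0,1]$ and $x^0\in\mathbb R^n$, and let $\{x^k\}$ be any sequence generated by the following algorithm. For $k=0,1,2,\dots$: 1. Select $H^k\in\hat\partial^2F_\gamma(x^k)$ and set $\delta_k=\zeta\|\nabla F_\gamma(x^k)\|$, $\eta_k=\min\{\bar\eta,\|\nabla F_\gamma(x^k)\|^\rho\}$. Apply the conjugate gradient method, started at $0$, to $(H^k+\delta_kI)d=-\nabla F_\gamma(x^k)$, and let $d^k$ be one of its iterates that satisfies $\|(H^k+\delta_kI)d^k+\nabla F_\gamma(x^k)\|\le\eta_k\|\nabla F_\gamma(x^k)\|$. 2. Let $\tau_k$ be the largest number in $\{2^{-i}: i=0,1,2,\dots\}$ such that $F_\gamma(x^k+\tau_kd^k)\le F_\gamma(x^k)+\sigma\tau_k\langle\nabla F_\gamma(x^k),d^k\rangle$. 3. Set $x^{k+1}=x^k+\tau_kd^k$. Then every accumulation point of $\{x^k\}$ belongs to $X_\star$. -/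

import Mathlib

open Filter Topology
open scoped NNReal

noncomputable section

/-- The class of twice continuously differentiable functions that are strongly convex with modulus
`μ ≥ 0` (plain convexity when `μ = 0`) and whose gradient is Lipschitz with constant `L`. -/
structure SmoothConvexClass {E : Type*} [NormedAddCommGroup E] [InnerProductSpace ℝ E]
    [CompleteSpace E] (μ : ℝ) (L : ℝ≥0) (f : E → ℝ) : Prop where
  modulus_nonneg : 0 ≤ μ
  contDiff : ContDiff ℝ 2 f
  strongConvex : StrongConvexOn Set.univ μ f
  lipschitz : LipschitzWith L (gradient f)

/-- Proper, lower semicontinuous, convex functions with values in `ℝ ∪ {+∞}`; convexity is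
convexity of the epigraph. -/
structure ProperLscConvex {E : Type*} [NormedAddCommGroup E] [InnerProductSpace ℝ E]
    (g : E → EReal) : Prop where
  ne_bot : ∀ x, g x ≠ ⊥
  exists_ne_top : ∃ x, g x ≠ ⊤
  lsc : LowerSemicontinuous g
  convex_epigraph : Convex ℝ {p : E × ℝ | g p.1 ≤ (p.2 : EReal)}

/-- The set of (global) solutions of the problem of minimizing `F = f + g`. -/
def solutionSet {E : Type*} (f : E → ℝ) (g : E → EReal) : Set E :=
  {x | ∀ y, (f x : EReal) + g x ≤ (f y : EReal) + g y}

/-- The objective `u ↦ g u + (1 / (2γ)) ‖u - x‖²` of the proximal problem at `x`. -/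
def proxObjective {E : Type*} [NormedAddCommGroup E] (γ : ℝ) (g : E → EReal) (x u : E) : EReal :=
  g u + ((1 / (2 * γ) * ‖u - x‖ ^ 2 : ℝ) : EReal)

/-- The proximal mapping: a minimizer of the proximal objective. For `γ > 0` and `g` proper,
lower semicontinuous and convex on `ℝⁿ` there is exactly one. -/
def prox {E : Type*} [NormedAddCommGroup E] (γ : ℝ) (g : E → EReal) (x : E) : E :=
  Classical.epsilon fun u => ∀ v, proxObjective γ g x u ≤ proxObjective γ g x v

/-- The Moreau envelope: the optimal value of the proximal problem. -/
def moreauEnvelope {E : Type*} [NormedAddCommGroup E] (γ : ℝ) (g : E → EReal) (x : E) : EReal :=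
  ⨅ u, proxObjective γ g x u

/-- The forward-backward envelope
`F_γ x = f x - (γ / 2) ‖∇f x‖² + g^γ (x - γ ∇f x)`. The Moreau envelope of a proper, lower
semicontinuous, convex function is finite everywhere, so `toReal` only changes the type. -/
def fbe {E : Type*} [NormedAddCommGroup E] [InnerProductSpace ℝ E] [CompleteSpace E]
    (γ : ℝ) (f : E → ℝ) (g : E → EReal) (x : E) : ℝ :=
  f x - γ / 2 * ‖gradient f x‖ ^ 2 + (moreauEnvelope γ g (x - γ • gradient f x)).toReal

/-- The B-subdifferential (limiting Jacobian) of `G` at `x`. -/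
def bSubdifferential {E : Type*} [NormedAddCommGroup E] [InnerProductSpace ℝ E]
    (G : E → E) (x : E) : Set (E →L[ℝ] E) :=
  {J | ∃ u : ℕ → E, (∀ k, DifferentiableAt ℝ G (u k)) ∧ Tendsto u atTop (𝓝 x) ∧
    Tendsto (fun k => fderiv ℝ G (u k)) atTop (𝓝 J)}

/-- The (Clarke) generalized Jacobian of `G` at `x`. -/
def clarkeJacobian {E : Type*} [NormedAddCommGroup E] [InnerProductSpace ℝ E]
    (G : E → E) (x : E) : Set (E →L[ℝ] E) :=
  convexHull ℝ (bSubdifferential G x)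

/-- The Hessian of `f` at `x`, as a linear operator: the derivative of the gradient. -/
def hessian {E : Type*} [NormedAddCommGroup E] [InnerProductSpace ℝ E] [CompleteSpace E]
    (f : E → ℝ) (x : E) : E →L[ℝ] E :=
  fderiv ℝ (gradient f) x

/-- The approximate generalized Hessian of the forward-backward envelope: all operators
`γ⁻¹ (I - γ ∇²f x) (I - P (I - γ ∇²f x))` with `P` in the generalized Jacobian of `prox_{γ g}`
at `x - γ ∇f x`. -/
def approxHessian {E : Type*} [NormedAddCommGroup E] [InnerProductSpace ℝ E] [CompleteSpace E]
    (γ : ℝ) (f : E → ℝ) (g : E → EReal) (x : E) : Set (E →L[ℝ] E) :=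
  {H | ∃ P ∈ clarkeJacobian (prox γ g) (x - γ • gradient f x),
    H = γ⁻¹ • ((1 - γ • hessian f x) * (1 - P * (1 - γ • hessian f x)))}

/-- The state of the conjugate gradient method: iterate, residual and search direction. -/
structure CGState (E : Type*) where
  iter : E
  res : E
  dir : E

/-- One step of the conjugate gradient method for `A d = b`. Once the residual is zero, the
convention `0 / 0 = 0` leaves the iterate unchanged. -/
def CGState.next {E : Type*} [NormedAddCommGroup E] [InnerProductSpace ℝ E]
    (A : E →L[ℝ] E) (s : CGState E) : CGState E :=
  let a : ℝ := ‖s.res‖ ^ 2 / inner ℝ s.dir (A s.dir)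
  let r : E := s.res - a • A s.dir
  { iter := s.iter + a • s.dir
    res := r
    dir := r + (‖r‖ ^ 2 / ‖s.res‖ ^ 2) • s.dir }

/-- The conjugate gradient method for `A d = b`, started at `0`. -/
def cgState {E : Type*} [NormedAddCommGroup E] [InnerProductSpace ℝ E]
    (A : E →L[ℝ] E) (b : E) : ℕ → CGState E
  | 0 => { iter := 0, res := b, dir := b }
  | j + 1 => (cgState A b j).next A

/-- The `j`-th iterate of the conjugate gradient method for `A d = b`, started at `0`. -/
def cgIterate {E : Type*} [NormedAddCommGroup E] [InnerProductSpace ℝ E]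
    (A : E →L[ℝ] E) (b : E) (j : ℕ) : E :=
  (cgState A b j).iter

/-- `d` is an inexact regularized Newton direction at `x`: for some `H` in the approximate
generalized Hessian, `δ = ζ ‖∇F_γ x‖` and `η = min {ηbar, ‖∇F_γ x‖ ^ ρ}`, it is a conjugate gradient
iterate for `(H + δ I) d = -∇F_γ x` with relative residual at most `η`. -/
def IsNewtonCGDirection {E : Type*} [NormedAddCommGroup E] [InnerProductSpace ℝ E]
    [CompleteSpace E] (f : E → ℝ) (g : E → EReal) (γ ηbar ζ ρ : ℝ) (x d : E) : Prop :=
  ∃ H ∈ approxHessian γ f g x,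
    let v : E := gradient (fbe γ f g) x
    let A : E →L[ℝ] E := H + (ζ * ‖v‖) • (1 : E →L[ℝ] E)
    (∃ j : ℕ, d = cgIterate A (-v) j) ∧ ‖A d + v‖ ≤ min ηbar (‖v‖ ^ ρ) * ‖v‖

/-- `τ` is the largest number among `1, 1/2, 1/4, …` that satisfies the sufficient decrease
condition for `F_γ` at `x` in the direction `d`. -/
def IsArmijoStep {E : Type*} [NormedAddCommGroup E] [InnerProductSpace ℝ E]
    [CompleteSpace E] (f : E → ℝ) (g : E → EReal) (γ σ : ℝ) (x d : E) (τ : ℝ) : Prop :=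
  IsGreatest {t : ℝ | (∃ i : ℕ, t = (1 / 2) ^ i) ∧
    fbe γ f g (x + t • d) ≤ fbe γ f g x + σ * t * inner ℝ (gradient (fbe γ f g) x) d} τ

/-- The sequence `x` is generated by the forward-backward Newton-CG method with parameters
`γ, σ, ηbar, ζ, ρ`, for some admissible choices of the generalized Hessians and of the number of
conjugate gradient steps. -/
def IsFBNCGSequence {E : Type*} [NormedAddCommGroup E] [InnerProductSpace ℝ E]
    [CompleteSpace E] (f : E → ℝ) (g : E → EReal) (γ σ ηbar ζ ρ : ℝ) (x : ℕ → E) : Prop :=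
  ∀ k, ∃ (d : E) (τ : ℝ), IsNewtonCGDirection f g γ ηbar ζ ρ (x k) d ∧
    IsArmijoStep f g γ σ (x k) d τ ∧ x (k + 1) = x k + τ • d

end

/-! The envelope `fbe` is a C¹ function with gradient `γ⁻¹ Q (x - p)`, where `Q = I - γ∇²f x` and
`p` is the forward-backward step from `x` (`hasGradientAt_fbe`). Since `γL < 1`, `Q` is coercive, so
a stationary point satisfies `x = p`; hence `-∇f x` is a subgradient of `g` at `x`, and convexity
makes `x` a minimizer (`mem_solutionSet_of_gradient_fbe_eq_zero`).

It remains to show that accumulation points are stationary. Elements of the Clarke Jacobian of prox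
are symmetric contractions and `Q² ≤ Q`, so each approximate Hessian is symmetric, positive
semidefinite and bounded by `2/γ`. Regularization makes the Newton system positive definite, and a
conjugate gradient iterate is orthogonal to its residual (`inner_sub_cgIterate_eq_zero`). Therefore
`-⟨v, d⟩ = ⟨A d, d⟩` even for a truncated solve, which yields descent and two-sided control of `‖d‖`
(`IsNewtonCGDirection.bounds`). The classical Armijo argument then excludes a nonstationary cluster
point (`gradient_eq_zero_of_armijo`). -/

/-! ### Proximal mapping and Moreau envelope. -/

section Prox

variable {E : Type*} [NormedAddCommGroup E] [InnerProductSpace ℝ E]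

/-- A real number whose products with small `t > 0` are bounded below by `-t ^ 2 * β` is
nonnegative. -/
theorem nonneg_of_forall_quadratic_nonneg {α β : ℝ}
    (h : ∀ t : ℝ, 0 < t → t ≤ 1 → 0 ≤ t * α + t ^ 2 * β) : 0 ≤ α := by
  have hlim : Tendsto (fun t : ℝ => α + t * β) (𝓝[>] 0) (𝓝 (α + 0 * β)) :=
    ((continuous_const.add (continuous_id.mul continuous_const)).tendsto 0).mono_left
      nhdsWithin_le_nhds
  rw [zero_mul, add_zero] at hlim
  refine ge_of_tendsto hlim ?_
  filter_upwards [Ioc_mem_nhdsGT (zero_lt_one : (0 : ℝ) < 1)] with t ht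
  have := h t ht.1 ht.2
  rw [show t * α + t ^ 2 * β = t * (α + t * β) by ring] at this
  exact nonneg_of_mul_nonneg_right this ht.1

namespace ProperLscConvex

variable {g : E → EReal}

theorem le_of_convex_combination (hg : ProperLscConvex g) {x y : E} {a b s t : ℝ}
    (hx : g x ≤ a) (hy : g y ≤ b) (hs : 0 ≤ s) (ht : 0 ≤ t) (hst : s + t = 1) :
    g (s • x + t • y) ≤ ((s * a + t * b : ℝ) : EReal) := by
  have := hg.convex_epigraph (x := (x, a)) hx (y := (y, b)) hy hs ht hst
  simpa using this

theorem eq_coe_of_le (hg : ProperLscConvex g) {x : E} {r : ℝ} (h : g x ≤ r) :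
    ∃ a : ℝ, g x = a :=
  ⟨(g x).toReal, (EReal.coe_toReal (h.trans_lt (EReal.coe_lt_top r)).ne (hg.ne_bot x)).symm⟩

/-- A proper, lower semicontinuous, convex function grows at least linearly downwards. -/
theorem exists_linear_lower_bound [FiniteDimensional ℝ E] (hg : ProperLscConvex g) :
    ∃ (x₀ : E) (a C : ℝ), g x₀ = a ∧ 0 ≤ C ∧
      ∀ (u : E) (r : ℝ), g u ≤ r → a - C * (1 + ‖u - x₀‖) ≤ r := by
  obtain ⟨x₀, hx₀⟩ := hg.exists_ne_top
  have ha : g x₀ = ((g x₀).toReal : EReal) := (EReal.coe_toReal hx₀ (hg.ne_bot x₀)).symm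
  set a := (g x₀).toReal
  have := FiniteDimensional.proper ℝ E
  obtain ⟨m₀, hm₀, hmin⟩ := (hg.lsc.lowerSemicontinuousOn (Metric.closedBall x₀ 1)).exists_isMinOn
    ⟨x₀, Metric.mem_closedBall_self zero_le_one⟩ (isCompact_closedBall x₀ 1)
  have hm : ∀ u ∈ Metric.closedBall x₀ 1, g m₀ ≤ g u := fun u hu => hmin hu
  have hma : g m₀ ≤ a := ha ▸ hm x₀ (Metric.mem_closedBall_self zero_le_one)
  obtain ⟨m, hmm⟩ := hg.eq_coe_of_le hma
  rw [hmm] at hm hma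
  have hma' : m ≤ a := by exact_mod_cast hma
  refine ⟨x₀, a, a - m, ha, sub_nonneg.2 hma', fun u r hr => ?_⟩
  have hC : 0 ≤ a - m := sub_nonneg.2 hma'
  -- Outside the unit ball, the segment from `x₀` to `u` crosses the unit sphere, where `g ≥ m`;
  -- convexity extrapolates this bound to `u`.
  rcases le_total ‖u - x₀‖ 1 with h1 | h1
  · have : m ≤ r := by
      exact_mod_cast (hm u (by rwa [Metric.mem_closedBall, dist_eq_norm])).trans hr
    nlinarith [norm_nonneg (u - x₀)]
  · have ht : 0 < ‖u - x₀‖ := by linarith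
    set t := ‖u - x₀‖ with htdef
    have hinv : t⁻¹ ≤ 1 := inv_le_one_of_one_le₀ h1
    have hcomb := hg.le_of_convex_combination ha.le hr (s := 1 - t⁻¹) (t := t⁻¹)
      (by linarith) (by positivity) (by ring)
    have hball : (1 - t⁻¹) • x₀ + t⁻¹ • u ∈ Metric.closedBall x₀ 1 := by
      rw [Metric.mem_closedBall, dist_eq_norm,
        show (1 - t⁻¹) • x₀ + t⁻¹ • u - x₀ = t⁻¹ • (u - x₀) by module, norm_smul, ← htdef,
        Real.norm_of_nonneg (by positivity), inv_mul_cancel₀ ht.ne']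
    have h2 : m ≤ (1 - t⁻¹) * a + t⁻¹ * r := by exact_mod_cast (hm _ hball).trans hcomb
    have h3 : t * m ≤ (t - 1) * a + r := by
      calc t * m ≤ t * ((1 - t⁻¹) * a + t⁻¹ * r) := by gcongr
        _ = (t - t * t⁻¹) * a + t * t⁻¹ * r := by ring
        _ = (t - 1) * a + r := by rw [mul_inv_cancel₀ ht.ne', one_mul]
    nlinarith

theorem lowerSemicontinuous_proxObjective (hg : ProperLscConvex g) (γ : ℝ) (x : E) :
    LowerSemicontinuous (proxObjective γ g x) := by
  refine hg.lsc.add' (Continuous.lowerSemicontinuous ?_) fun u => ?_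
  · exact continuous_coe_real_ereal.comp (by fun_prop)
  · exact EReal.continuousAt_add (Or.inr (EReal.coe_ne_bot _)) (Or.inr (EReal.coe_ne_top _))

theorem exists_prox_minimizer [FiniteDimensional ℝ E] (hg : ProperLscConvex g) {γ : ℝ}
    (hγ : 0 < γ) (x : E) : ∃ u, ∀ v, proxObjective γ g x u ≤ proxObjective γ g x v := by
  obtain ⟨x₀, a, C, ha, hC, hlow⟩ := hg.exists_linear_lower_bound
  have := FiniteDimensional.proper ℝ E
  set D := ‖x₀ - x‖ with hD
  have hDn : 0 ≤ D := norm_nonneg _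
  set c := 1 / (2 * γ) with hc
  have hcp : 0 < c := by positivity
  set K := C * (1 + D) + c * D ^ 2 with hK
  have hKn : 0 ≤ K := by positivity
  -- Beyond radius `R` the quadratic term outweighs the linear lower bound on `g`, so the objective
  -- there is no less than at `x₀`; `D ≤ R` keeps `x₀` in the ball.
  set R := max D (1 + (C + 1 + K) / c) with hR
  have hmem : x₀ ∈ Metric.closedBall x R := by
    rw [Metric.mem_closedBall, dist_eq_norm]; exact le_max_left _ _
  obtain ⟨p, hp, hmin⟩ := ((hg.lowerSemicontinuous_proxObjective γ x).lowerSemicontinuousOn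
    (Metric.closedBall x R)).exists_isMinOn ⟨x₀, hmem⟩ (isCompact_closedBall x R)
  refine ⟨p, fun v => ?_⟩
  by_cases hv : v ∈ Metric.closedBall x R
  · exact hmin hv
  · refine (show proxObjective γ g x p ≤ proxObjective γ g x x₀ from hmin hmem).trans ?_
    unfold proxObjective
    rw [ha]
    by_cases htop : g v = ⊤
    · rw [htop, EReal.top_add_coe]; exact le_top
    have hgv : g v = ((g v).toReal : EReal) := (EReal.coe_toReal htop (hg.ne_bot v)).symm
    have hb := hlow v _ hgv.le
    rw [hgv, ← EReal.coe_add, ← EReal.coe_add, EReal.coe_le_coe_iff, ← hc, ← hD]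
    rw [Metric.mem_closedBall, dist_eq_norm, not_le] at hv
    set s := ‖v - x‖
    have hs : 1 + (C + 1 + K) / c < s := (le_max_right _ _).trans_lt hv
    have hs1 : 1 ≤ s := by
      have : 0 ≤ (C + 1 + K) / c := by positivity
      linarith
    have hs2 : C + 1 + K ≤ c * s := by
      have : (C + 1 + K) / c ≤ s := by linarith
      rwa [div_le_iff₀ hcp, mul_comm] at this
    have htri : ‖v - x₀‖ ≤ s + D := by
      rw [hD, norm_sub_rev x₀ x, show v - x₀ = (v - x) + (x - x₀) by abel]
      exact norm_add_le _ _
    have h4 : C * (1 + ‖v - x₀‖) ≤ C * (1 + (s + D)) := by gcongr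
    have h5 : (C + 1 + K) * s ≤ c * s * s := by gcongr
    nlinarith

variable [FiniteDimensional ℝ E]

theorem proxObjective_prox_le (hg : ProperLscConvex g) {γ : ℝ} (hγ : 0 < γ) (x v : E) :
    proxObjective γ g x (prox γ g x) ≤ proxObjective γ g x v :=
  Classical.epsilon_spec (hg.exists_prox_minimizer hγ x) v

/-- `γ⁻¹ (x - prox x)` is a subgradient of `g` at `prox x`. -/
theorem prox_spec (hg : ProperLscConvex g) {γ : ℝ} (hγ : 0 < γ) (x : E) :
    ∃ a : ℝ, g (prox γ g x) = a ∧ ∀ (u : E) (r : ℝ), g u ≤ r →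
      a + γ⁻¹ * inner ℝ (x - prox γ g x) (u - prox γ g x) ≤ r := by
  have hmin := hg.proxObjective_prox_le hγ x
  set p := prox γ g x
  obtain ⟨a, ha⟩ : ∃ a : ℝ, g p = a := by
    obtain ⟨x₀, hx₀⟩ := hg.exists_ne_top
    refine ⟨(g p).toReal, (EReal.coe_toReal (fun h => ?_) (hg.ne_bot p)).symm⟩
    have := hmin x₀
    unfold proxObjective at this
    rw [h, EReal.top_add_coe, ← EReal.coe_toReal hx₀ (hg.ne_bot x₀), ← EReal.coe_add] at this
    exact EReal.coe_ne_top _ (top_le_iff.1 this)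
  refine ⟨a, ha, fun u r hr => ?_⟩
  -- First-order optimality: compare `p` with `(1 - t) p + t u` and let `t → 0`.
  have key : 0 ≤ (r - a) + γ⁻¹ * inner ℝ (p - x) (u - p) := by
    refine nonneg_of_forall_quadratic_nonneg (β := 1 / (2 * γ) * ‖u - p‖ ^ 2) fun t ht0 ht1 => ?_
    have h1 := hg.le_of_convex_combination ha.le hr (s := 1 - t) (t := t) (by linarith) ht0.le
      (by ring)
    have h2 := (hmin ((1 - t) • p + t • u)).trans (add_le_add_left h1 _)
    unfold proxObjective at h2
    rw [ha, ← EReal.coe_add, ← EReal.coe_add, EReal.coe_le_coe_iff,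
      show (1 - t) • p + t • u - x = (p - x) + t • (u - p) by module, norm_add_sq_real,
      inner_smul_right, norm_smul, mul_pow, Real.norm_eq_abs, sq_abs] at h2
    have h3 : 1 / (2 * γ) * (2 * (t * inner ℝ (p - x) (u - p))) =
        t * (γ⁻¹ * inner ℝ (p - x) (u - p)) := by
      field_simp
    nlinarith
  have : inner ℝ (x - p) (u - p) = -inner ℝ (p - x) (u - p) := by
    rw [← inner_neg_left, neg_sub]
  rw [this]
  linarith

theorem moreauEnvelope_eq (hg : ProperLscConvex g) {γ : ℝ} (hγ : 0 < γ) (x : E) :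
    moreauEnvelope γ g x = proxObjective γ g x (prox γ g x) :=
  le_antisymm (iInf_le _ _) (le_iInf (hg.proxObjective_prox_le hγ x))

/-- The proximal mapping is firmly nonexpansive. -/
theorem norm_sq_prox_sub_le (hg : ProperLscConvex g) {γ : ℝ} (hγ : 0 < γ) (x y : E) :
    ‖prox γ g x - prox γ g y‖ ^ 2 ≤ inner ℝ (prox γ g x - prox γ g y) (x - y) := by
  obtain ⟨a, ha, hxa⟩ := hg.prox_spec hγ x
  obtain ⟨b, hb, hyb⟩ := hg.prox_spec hγ y
  have h1 := hxa _ b hb.le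
  have h2 := hyb _ a ha.le
  set p := prox γ g x
  set q := prox γ g y
  have h3 : γ⁻¹ * (inner ℝ (x - p) (q - p) + inner ℝ (y - q) (p - q)) ≤ 0 := by
    rw [mul_add]; linarith
  have h4 : inner ℝ (x - p) (q - p) + inner ℝ (y - q) (p - q) =
      ‖p - q‖ ^ 2 - inner ℝ (p - q) (x - y) := by
    rw [← real_inner_self_eq_norm_sq]
    simp only [inner_sub_left, inner_sub_right]
    rw [real_inner_comm p x, real_inner_comm q x, real_inner_comm p y, real_inner_comm q y,
      real_inner_comm q p]
    ring
  rw [h4] at h3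
  have := nonpos_of_mul_nonpos_right h3 (inv_pos.2 hγ)
  linarith

theorem lipschitzWith_prox (hg : ProperLscConvex g) {γ : ℝ} (hγ : 0 < γ) :
    LipschitzWith 1 (prox γ g) := by
  refine LipschitzWith.of_dist_le_mul fun x y => ?_
  rw [dist_eq_norm, dist_eq_norm, NNReal.coe_one, one_mul]
  have h := (hg.norm_sq_prox_sub_le hγ x y).trans (real_inner_le_norm _ _)
  rcases (norm_nonneg (prox γ g x - prox γ g y)).eq_or_lt with h0 | h0
  · rw [← h0]; exact norm_nonneg _
  · rw [sq] at h; exact le_of_mul_le_mul_left h h0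

/-- Using `prox γ g x` as a competitor in the proximal problem at `y` gives this upper half of the
first-order expansion. -/
theorem moreauEnvelope_sub_le (hg : ProperLscConvex g) {γ : ℝ} (hγ : 0 < γ) (x y : E) :
    (moreauEnvelope γ g y).toReal - (moreauEnvelope γ g x).toReal ≤
      γ⁻¹ * inner ℝ (x - prox γ g x) (y - x) + 1 / (2 * γ) * ‖y - x‖ ^ 2 := by
  obtain ⟨b, hb, -⟩ := hg.prox_spec hγ y
  obtain ⟨a, ha, -⟩ := hg.prox_spec hγ x
  have hle := hg.proxObjective_prox_le hγ y (prox γ g x)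
  rw [hg.moreauEnvelope_eq hγ, hg.moreauEnvelope_eq hγ]
  unfold proxObjective at hle ⊢
  rw [ha, hb, ← EReal.coe_add, ← EReal.coe_add, EReal.coe_le_coe_iff] at hle
  rw [ha, hb, ← EReal.coe_add, ← EReal.coe_add, EReal.toReal_coe, EReal.toReal_coe]
  set p := prox γ g x
  have h1 : ‖p - y‖ ^ 2 = ‖p - x‖ ^ 2 + 2 * inner ℝ (x - p) (y - x) + ‖y - x‖ ^ 2 := by
    rw [norm_sub_rev p y, norm_sub_rev p x, show y - p = (x - p) + (y - x) by abel,
      norm_add_sq_real]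
  rw [h1] at hle
  have h2 : 1 / (2 * γ) * (2 * inner ℝ (x - p) (y - x)) = γ⁻¹ * inner ℝ (x - p) (y - x) := by
    field_simp
  linarith

theorem inner_sub_prox_nonneg (hg : ProperLscConvex g) {γ : ℝ} (hγ : 0 < γ) (x y : E) :
    0 ≤ inner ℝ ((y - prox γ g y) - (x - prox γ g x)) (y - x) := by
  have h := hg.norm_sq_prox_sub_le hγ y x
  have h' : ‖prox γ g y - prox γ g x‖ ≤ ‖y - x‖ := by
    simpa [dist_eq_norm] using (hg.lipschitzWith_prox hγ).dist_le_mul y x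
  rw [show (y - prox γ g y) - (x - prox γ g x) = (y - x) - (prox γ g y - prox γ g x) by abel,
    inner_sub_left, real_inner_self_eq_norm_sq]
  have := real_inner_le_norm (prox γ g y - prox γ g x) (y - x)
  nlinarith [norm_nonneg (y - x)]

/-- The Moreau envelope is differentiable with gradient `γ⁻¹ (x - prox x)`. -/
theorem hasGradientAt_moreauEnvelope (hg : ProperLscConvex g) {γ : ℝ} (hγ : 0 < γ) (x : E) :
    HasGradientAt (fun y => (moreauEnvelope γ g y).toReal) (γ⁻¹ • (x - prox γ g x)) x := by
  rw [hasGradientAt_iff_isLittleO]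
  have hO : (fun y => (moreauEnvelope γ g y).toReal - (moreauEnvelope γ g x).toReal -
      inner ℝ (γ⁻¹ • (x - prox γ g x)) (y - x)) =O[𝓝 x] fun y => ‖y - x‖ ^ 2 := by
    refine Asymptotics.IsBigO.of_bound (1 / (2 * γ)) (Eventually.of_forall fun y => ?_)
    rw [inner_smul_left, RCLike.conj_to_real, Real.norm_eq_abs, Real.norm_of_nonneg (by positivity),
      abs_le]
    -- The bound with `x` and `y` swapped has its slope at `y`; monotonicity of `I - prox` moves it
    -- to `x` and gives the matching lower bound.
    have h1 := hg.moreauEnvelope_sub_le hγ x y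
    have h2 := hg.moreauEnvelope_sub_le hγ y x
    have h3 := mul_nonneg (inv_pos.2 hγ).le (hg.inner_sub_prox_nonneg hγ x y)
    rw [inner_sub_left, mul_sub] at h3
    rw [norm_sub_rev x y, ← neg_sub y x, inner_neg_right] at h2
    constructor <;> linarith
  refine hO.trans_isLittleO ?_
  have h : Tendsto (fun y => y - x) (𝓝 x) (𝓝 0) := by
    simpa using (continuous_sub_right x).tendsto x
  exact ((Asymptotics.isLittleO_norm_pow_id one_lt_two).comp_tendsto h)

end ProperLscConvex

end Prox

/-! ### Gradient fields: symmetry, monotonicity, restriction to lines. -/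

section Gradient

variable {E : Type*} [NormedAddCommGroup E] [InnerProductSpace ℝ E]

/-- The derivative of a monotone operator is positive semidefinite. -/
theorem inner_fderiv_nonneg_of_monotone {G : E → E} {D : E →L[ℝ] E} {x : E}
    (hG : ∀ y z, 0 ≤ inner ℝ (G y - G z) (y - z)) (hD : HasFDerivAt G D x) (v : E) :
    0 ≤ inner ℝ (D v) v := by
  have hlim := (hD.lim v (c := fun n : ℕ => (n : ℝ)) (l := atTop)
    (by simpa using tendsto_natCast_atTop_atTop)).inner (𝕜 := ℝ) (tendsto_const_nhds (x := v))
  refine ge_of_tendsto hlim (eventually_atTop.2 ⟨1, fun n hn => ?_⟩)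
  have hn' : (0 : ℝ) < n := by exact_mod_cast hn
  have h := hG (x + (n : ℝ)⁻¹ • v) x
  rw [add_sub_cancel_left, inner_smul_right] at h
  rw [inner_smul_left, RCLike.conj_to_real]
  exact mul_nonneg hn'.le (nonneg_of_mul_nonneg_right h (inv_pos.2 hn'))

variable [CompleteSpace E]

theorem ContDiff.gradient_of_two {f : E → ℝ} (hf : ContDiff ℝ 2 f) :
    ContDiff ℝ 1 (gradient f) := by
  have h : ContDiff ℝ 1 (fderiv ℝ f) := hf.fderiv_right le_rfl
  exact ContDiff.comp (g := (InnerProductSpace.toDual ℝ E).symm)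
    (LinearIsometryEquiv.contDiff (𝕜 := ℝ) (InnerProductSpace.toDual ℝ E).symm) h

/-- The derivative of a gradient field is symmetric wherever it exists. -/
theorem inner_fderiv_symm_of_hasGradientAt {φ : E → ℝ} {G : E → E} {D : E →L[ℝ] E} {x : E}
    (hφ : ∀ y, HasGradientAt φ (G y) y) (hD : HasFDerivAt G D x) (u v : E) :
    inner ℝ (D u) v = inner ℝ u (D v) := by
  let B : E →L[ℝ] E →L[ℝ] ℝ := innerSL ℝ
  rw [real_inner_comm (D v) u]
  exact second_derivative_symmetric (f' := fun y => B (G y)) hφ (B.hasFDerivAt.comp x hD) u v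

theorem HasGradientAt.hasDerivAt_line {φ : E → ℝ} {G : E → E}
    (hφ : ∀ y, HasGradientAt φ (G y) y) (x d : E) (t : ℝ) :
    HasDerivAt (fun s : ℝ => φ (x + s • d)) (inner ℝ (G (x + t • d)) d) t := by
  have h1 : HasDerivAt (fun s : ℝ => x + s • d) d t := by
    simpa using ((hasDerivAt_id t).smul_const d).const_add x
  exact (hφ (x + t • d)).hasFDerivAt.comp_hasDerivAt t h1

theorem ConvexOn.add_inner_gradient_le {f : E → ℝ} (hf : ConvexOn ℝ Set.univ f)
    (hd : Differentiable ℝ f) (x y : E) : f x + inner ℝ (gradient f x) (y - x) ≤ f y := by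
  have hline := HasGradientAt.hasDerivAt_line (fun z => (hd z).hasGradientAt) x (y - x) 0
  have hconv : ConvexOn ℝ Set.univ fun s : ℝ => f (x + s • (y - x)) := by
    have h := hf.comp_affineMap (AffineMap.lineMap x y)
    rw [Set.preimage_univ] at h
    refine h.congr fun s _ => ?_
    simp [AffineMap.lineMap_apply, add_comm]
  have h := hconv.le_slope_of_hasDerivAt (Set.mem_univ 0) (Set.mem_univ 1) zero_lt_one hline
  simp only [slope_def_field, zero_smul, one_smul, add_zero, sub_zero, div_one,
    add_sub_cancel] at h
  linarith

end Gradient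

/-! ### Spectral bounds for `I - γ∇²f`. -/

section SmoothConvex

variable {E : Type*} [NormedAddCommGroup E] [InnerProductSpace ℝ E] [CompleteSpace E]

namespace SmoothConvexClass

variable {μ : ℝ} {L : ℝ≥0} {f : E → ℝ}

theorem differentiable (hf : SmoothConvexClass μ L f) : Differentiable ℝ f :=
  hf.contDiff.differentiable (by norm_num)

theorem add_inner_gradient_le (hf : SmoothConvexClass μ L f) (x y : E) :
    f x + inner ℝ (gradient f x) (y - x) ≤ f y :=
  (strongConvexOn_zero.1 (hf.strongConvex.mono hf.modulus_nonneg)).add_inner_gradient_le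
    hf.differentiable x y

theorem hasFDerivAt_gradient (hf : SmoothConvexClass μ L f) (x : E) :
    HasFDerivAt (gradient f) (hessian f x) x :=
  (hf.contDiff.gradient_of_two.differentiable one_ne_zero x).hasFDerivAt

theorem continuous_hessian (hf : SmoothConvexClass μ L f) : Continuous (hessian f) :=
  hf.contDiff.gradient_of_two.continuous_fderiv one_ne_zero

theorem inner_hessian_symm (hf : SmoothConvexClass μ L f) (x u v : E) :
    inner ℝ (hessian f x u) v = inner ℝ u (hessian f x v) :=
  inner_fderiv_symm_of_hasGradientAt (fun y => (hf.differentiable y).hasGradientAt)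
    (hf.hasFDerivAt_gradient x) u v

theorem inner_hessian_nonneg (hf : SmoothConvexClass μ L f) (x v : E) :
    0 ≤ inner ℝ (hessian f x v) v := by
  refine inner_fderiv_nonneg_of_monotone (fun y z => ?_) (hf.hasFDerivAt_gradient x) v
  have h1 := hf.add_inner_gradient_le y z
  have h2 := hf.add_inner_gradient_le z y
  rw [← neg_sub y z, inner_neg_right] at h1
  rw [inner_sub_left]
  linarith

theorem norm_hessian_le (hf : SmoothConvexClass μ L f) (x : E) : ‖hessian f x‖ ≤ L :=
  (hf.hasFDerivAt_gradient x).le_of_lipschitz hf.lipschitz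

variable {γ : ℝ}

theorem norm_smul_hessian_apply_le (hf : SmoothConvexClass μ L f) (hγ : 0 < γ) (x v : E) :
    ‖γ • hessian f x v‖ ≤ γ * L * ‖v‖ := by
  rw [norm_smul, Real.norm_of_nonneg hγ.le, mul_assoc]
  gcongr
  exact (hessian f x).le_of_opNorm_le (hf.norm_hessian_le x) v

/-- The operator `I - γ ∇²f x` is symmetric. -/
theorem inner_one_sub_smul_hessian_symm (hf : SmoothConvexClass μ L f) (γ : ℝ) (x u v : E) :
    inner ℝ ((1 - γ • hessian f x) u) v = inner ℝ u ((1 - γ • hessian f x) v) := by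
  simp [inner_sub_left, inner_sub_right, inner_smul_left, inner_smul_right,
    hf.inner_hessian_symm]

theorem one_sub_smul_hessian_coercive (hf : SmoothConvexClass μ L f) (hγ : 0 < γ) (x v : E) :
    (1 - γ * L) * ‖v‖ ^ 2 ≤ inner ℝ ((1 - γ • hessian f x) v) v := by
  have h1 := real_inner_le_norm (γ • hessian f x v) v
  have h2 := mul_le_mul_of_nonneg_right (hf.norm_smul_hessian_apply_le hγ x v) (norm_nonneg v)
  rw [sub_apply, one_apply_eq_self, smul_apply,
    inner_sub_left, real_inner_self_eq_norm_sq]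
  linarith

/-- `‖Q v‖² ≤ ⟨v, Q v⟩` for `Q = I - γ ∇²f x`. -/
theorem norm_sq_one_sub_smul_hessian_le (hf : SmoothConvexClass μ L f) (hγ : 0 < γ)
    (hγL : γ * L < 1) (x v : E) :
    ‖(1 - γ • hessian f x) v‖ ^ 2 ≤ inner ℝ v ((1 - γ • hessian f x) v) := by
  -- With `T = γ∇²f x` and `w = T v`, the claim is `‖w‖² ≤ ⟨w, v⟩`. It follows from `0 ≤ ⟨T(v - w),
  -- v - w⟩ = ⟨w, v⟩ - 2‖w‖² + ⟨T w, w⟩` and `‖T‖ ≤ 1`, without square roots of operators.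
  have hnn := hf.inner_hessian_nonneg x (v - γ • hessian f x v)
  have hle := hf.norm_smul_hessian_apply_le hγ x (γ • hessian f x v)
  have hsym := hf.inner_hessian_symm x v (γ • hessian f x v)
  set w := γ • hessian f x v with hw
  have hle' : inner ℝ (γ • hessian f x w) w ≤ ‖w‖ ^ 2 := by
    refine (real_inner_le_norm _ _).trans ?_
    rw [sq]
    gcongr
    exact hle.trans (mul_le_of_le_one_left (norm_nonneg _) hγL.le)
  have h1 : γ * inner ℝ (hessian f x (v - w)) (v - w) =
      inner ℝ w v - 2 * ‖w‖ ^ 2 + inner ℝ (γ • hessian f x w) w := by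
    have h2 : inner ℝ (γ • hessian f x w) v = ‖w‖ ^ 2 := by
      rw [inner_smul_left, RCLike.conj_to_real, real_inner_comm, ← hsym,
        ← real_inner_self_eq_norm_sq]
      nth_rewrite 2 [hw]
      rw [inner_smul_left, RCLike.conj_to_real]
    calc γ * inner ℝ (hessian f x (v - w)) (v - w)
        = inner ℝ (w - γ • hessian f x w) (v - w) := by
          rw [hw, ← smul_sub, ← map_sub, inner_smul_left, RCLike.conj_to_real]
      _ = inner ℝ w v - 2 * ‖w‖ ^ 2 + inner ℝ (γ • hessian f x w) w := by
          rw [inner_sub_left, inner_sub_right, inner_sub_right, h2, real_inner_self_eq_norm_sq]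
          ring
  have h3 : 0 ≤ γ * inner ℝ (hessian f x (v - w)) (v - w) := mul_nonneg hγ.le hnn
  have h4 : (1 - γ • hessian f x) v = v - w := rfl
  rw [h4, ← real_inner_self_eq_norm_sq, inner_sub_left v w, inner_sub_right w v,
    real_inner_self_eq_norm_sq w]
  linarith

theorem norm_one_sub_smul_hessian_le (hf : SmoothConvexClass μ L f) (hγ : 0 < γ)
    (hγL : γ * L < 1) (x : E) : ‖1 - γ • hessian f x‖ ≤ 1 := by
  refine ContinuousLinearMap.opNorm_le_bound _ zero_le_one fun v => ?_
  have h := (hf.norm_sq_one_sub_smul_hessian_le hγ hγL x v).trans (real_inner_le_norm _ _)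
  rw [one_mul]
  rcases (norm_nonneg ((1 - γ • hessian f x) v)).eq_or_lt with h0 | h0
  · rw [← h0]; exact norm_nonneg _
  · rw [sq] at h; exact le_of_mul_le_mul_right h h0

end SmoothConvexClass

end SmoothConvex

/-! ### Generalized Hessians, gradient and stationary points of the envelope. -/

section ForwardBackwardEnvelope

variable {E : Type*} [NormedAddCommGroup E] [InnerProductSpace ℝ E] [FiniteDimensional ℝ E]
  {μ : ℝ} {L : ℝ≥0} {f : E → ℝ} {g : E → EReal} {γ : ℝ}

/-- The derivative of the proximal mapping is symmetric. -/
theorem ProperLscConvex.inner_fderiv_prox_symm (hg : ProperLscConvex g) (hγ : 0 < γ) {x : E}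
    (hx : DifferentiableAt ℝ (prox γ g) x) (u v : E) :
    inner ℝ (fderiv ℝ (prox γ g) x u) v = inner ℝ u (fderiv ℝ (prox γ g) x v) := by
  -- This field is the gradient of the Moreau envelope, so its derivative is a symmetric second
  -- derivative.
  have hD : HasFDerivAt (fun y => γ⁻¹ • (y - prox γ g y))
      (γ⁻¹ • (ContinuousLinearMap.id ℝ E - fderiv ℝ (prox γ g) x)) x :=
    ((hasFDerivAt_id x).sub hx.hasFDerivAt).const_smul γ⁻¹
  have h := inner_fderiv_symm_of_hasGradientAt (fun y => hg.hasGradientAt_moreauEnvelope hγ y) hD u v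
  simp only [smul_apply, sub_apply,
    ContinuousLinearMap.id_apply, inner_smul_left, inner_smul_right, RCLike.conj_to_real,
    inner_sub_left, inner_sub_right] at h
  have := mul_left_cancel₀ (inv_ne_zero hγ.ne') h
  linarith

/-- Elements of the generalized Jacobian of the proximal mapping are symmetric contractions. -/
theorem ProperLscConvex.symm_and_norm_le_of_mem_clarkeJacobian (hg : ProperLscConvex g)
    (hγ : 0 < γ) {x : E} {P : E →L[ℝ] E} (hP : P ∈ clarkeJacobian (prox γ g) x) :
    (∀ u v, inner ℝ (P u) v = inner ℝ u (P v)) ∧ ‖P‖ ≤ 1 := by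
  -- Both properties are convex and survive limits, so they pass from actual derivatives to the
  -- Clarke Jacobian.
  let S : Set (E →L[ℝ] E) := {P | (∀ u v, inner ℝ (P u) v = inner ℝ u (P v)) ∧ ‖P‖ ≤ 1}
  have hconv : Convex ℝ S := by
    intro P hP R hR s t hs ht hst
    refine ⟨fun u v => ?_, ?_⟩
    · simp only [add_apply, smul_apply, inner_add_left,
        inner_add_right, inner_smul_left, inner_smul_right, RCLike.conj_to_real, hP.1 u v, hR.1 u v]
    · have h := convex_closedBall (0 : E →L[ℝ] E) 1 (x := P) (by simpa using hP.2)
        (y := R) (by simpa using hR.2) hs ht hst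
      simpa using h
  refine convexHull_min ?_ hconv hP
  rintro J ⟨u, hdiff, -, hJ⟩
  have happ : ∀ v, Tendsto (fun k => fderiv ℝ (prox γ g) (u k) v) atTop (𝓝 (J v)) := fun v =>
    ((ContinuousLinearMap.apply ℝ E v).continuous.tendsto J).comp hJ
  refine ⟨fun v w => ?_, ?_⟩
  · refine tendsto_nhds_unique ((happ v).inner tendsto_const_nhds) ?_
    simp_rw [fun k => hg.inner_fderiv_prox_symm hγ (hdiff k) v w]
    exact tendsto_const_nhds.inner (happ w)
  · refine le_of_tendsto hJ.norm (Eventually.of_forall fun k => ?_)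
    simpa using norm_fderiv_le_of_lipschitz ℝ (hg.lipschitzWith_prox hγ)

theorem inner_symm_of_mem_approxHessian (hf : SmoothConvexClass μ L f) (hg : ProperLscConvex g)
    (hγ : 0 < γ) {x : E} {H : E →L[ℝ] E} (hH : H ∈ approxHessian γ f g x) (u v : E) :
    inner ℝ (H u) v = inner ℝ u (H v) := by
  obtain ⟨P, hP, rfl⟩ := hH
  have hPs := (hg.symm_and_norm_le_of_mem_clarkeJacobian hγ hP).1
  have hQ := hf.inner_one_sub_smul_hessian_symm γ x
  set Q : E →L[ℝ] E := 1 - γ • hessian f x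
  simp only [smul_apply, mul_apply_eq_comp,
    sub_apply, one_apply_eq_self, inner_smul_left,
    inner_smul_right, RCLike.conj_to_real]
  rw [hQ, ← hQ u, inner_sub_left, inner_sub_right, hPs, hQ u v]

/-- Up to `γ⁻¹`, the form is `⟨u, Q u⟩ - ⟨P Q u, Q u⟩ ≥ ⟨u, Q u⟩ - ‖Q u‖²`, and `Q² ≤ Q`. -/
theorem inner_nonneg_of_mem_approxHessian (hf : SmoothConvexClass μ L f)
    (hg : ProperLscConvex g) (hγ : 0 < γ) (hγL : γ * L < 1) {x : E} {H : E →L[ℝ] E}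
    (hH : H ∈ approxHessian γ f g x) (u : E) : 0 ≤ inner ℝ (H u) u := by
  obtain ⟨P, hP, rfl⟩ := hH
  have hPn := (hg.symm_and_norm_le_of_mem_clarkeJacobian hγ hP).2
  have hQ := hf.inner_one_sub_smul_hessian_symm γ x
  have hQsq := hf.norm_sq_one_sub_smul_hessian_le hγ hγL x u
  set Q : E →L[ℝ] E := 1 - γ • hessian f x
  simp only [smul_apply, mul_apply_eq_comp,
    sub_apply, one_apply_eq_self, inner_smul_left,
    RCLike.conj_to_real]
  refine mul_nonneg (inv_pos.2 hγ).le ?_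
  rw [hQ, inner_sub_left]
  have h1 : inner ℝ (P (Q u)) (Q u) ≤ ‖Q u‖ ^ 2 := by
    refine (real_inner_le_norm _ _).trans ?_
    rw [sq]
    gcongr
    simpa using P.le_of_opNorm_le hPn (Q u)
  linarith

theorem norm_le_of_mem_approxHessian (hf : SmoothConvexClass μ L f)
    (hg : ProperLscConvex g) (hγ : 0 < γ) (hγL : γ * L < 1) {x : E} {H : E →L[ℝ] E}
    (hH : H ∈ approxHessian γ f g x) : ‖H‖ ≤ 2 / γ := by
  obtain ⟨P, hP, rfl⟩ := hH
  have hPn := (hg.symm_and_norm_le_of_mem_clarkeJacobian hγ hP).2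
  have hQn := hf.norm_one_sub_smul_hessian_le hγ hγL x
  set Q : E →L[ℝ] E := 1 - γ • hessian f x
  have h1 : ‖P * Q‖ ≤ 1 := (norm_mul_le _ _).trans (mul_le_one₀ hPn (norm_nonneg _) hQn)
  have h2 : ‖1 - P * Q‖ ≤ 2 := by
    have h3 : ‖(1 : E →L[ℝ] E)‖ ≤ 1 := ContinuousLinearMap.norm_id_le
    linarith [norm_sub_le (1 : E →L[ℝ] E) (P * Q)]
  have h3 : ‖Q * (1 - P * Q)‖ ≤ 1 * 2 := (norm_mul_le _ _).trans (by gcongr)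
  rw [norm_smul, Real.norm_of_nonneg (inv_pos.2 hγ).le, div_eq_inv_mul]
  gcongr
  linarith

/-- The gradient of the forward-backward envelope. -/
theorem hasGradientAt_fbe (hf : SmoothConvexClass μ L f) (hg : ProperLscConvex g) (hγ : 0 < γ)
    (x : E) : HasGradientAt (fbe γ f g)
      (γ⁻¹ • (1 - γ • hessian f x) (x - prox γ g (x - γ • gradient f x))) x := by
  have h1 := (hf.differentiable x).hasGradientAt.hasFDerivAt
  have hG := hf.hasFDerivAt_gradient x
  have h2 := (hG.norm_sq).const_mul (γ / 2)
  have h3 := ((hg.hasGradientAt_moreauEnvelope hγ (x - γ • gradient f x)).hasFDerivAt).comp x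
    ((hasFDerivAt_id x).sub (hG.const_smul γ))
  rw [hasGradientAt_iff_hasFDerivAt]
  -- The smooth part contributes `∇f - γ∇²f ∇f = Q ∇f`, which cancels the `-Q ∇f` coming from the
  -- Moreau term.
  refine ((h1.sub h2).add h3).congr_fderiv ?_
  ext v
  set p := prox γ g (x - γ • gradient f x)
  set Q : E →L[ℝ] E := 1 - γ • hessian f x with hQ
  have hQs : inner ℝ (Q (x - p)) v = inner ℝ (x - p) (Q v) :=
    hf.inner_one_sub_smul_hessian_symm γ x _ _
  have hQv : Q v = v - γ • hessian f x v := rfl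
  simp only [add_apply, sub_apply,
    smul_apply, ContinuousLinearMap.comp_apply, InnerProductSpace.toDual_apply_apply,
    innerSL_apply_apply, ContinuousLinearMap.id_apply, inner_smul_left, RCLike.conj_to_real, hQs, hQv,
    inner_sub_left, inner_sub_right, inner_smul_right, smul_eq_mul, nsmul_eq_mul]
  push_cast
  field_simp
  ring

theorem continuous_fbe_gradient (hf : SmoothConvexClass μ L f) (hg : ProperLscConvex g)
    (hγ : 0 < γ) : Continuous (gradient (fbe γ f g)) := by
  rw [gradient_eq fun x => hasGradientAt_fbe hf hg hγ x]
  have h1 := hf.continuous_hessian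
  have h2 := hf.lipschitz.continuous
  have h3 := (hg.lipschitzWith_prox hγ).continuous
  exact (((continuous_const.sub (h1.const_smul γ)).clm_apply
    (continuous_id.sub (h3.comp (continuous_id.sub (h2.const_smul γ)))))).const_smul _

/-- Stationary points of the forward-backward envelope minimize `f + g`. -/
theorem mem_solutionSet_of_gradient_fbe_eq_zero (hf : SmoothConvexClass μ L f)
    (hg : ProperLscConvex g) (hγ : 0 < γ) (hγL : γ * L < 1) {x : E}
    (hx : gradient (fbe γ f g) x = 0) : x ∈ solutionSet f g := by
  rw [(hasGradientAt_fbe hf hg hγ x).gradient, smul_eq_zero_iff_right (inv_ne_zero hγ.ne')] at hx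
  have hco := hf.one_sub_smul_hessian_coercive hγ x (x - prox γ g (x - γ • gradient f x))
  rw [hx, inner_zero_left] at hco
  have hp : prox γ g (x - γ • gradient f x) = x := by
    have := nonpos_of_mul_nonpos_right hco (sub_pos.2 hγL)
    rw [eq_comm, ← sub_eq_zero, ← norm_eq_zero]
    exact pow_eq_zero_iff two_ne_zero |>.1 (le_antisymm this (sq_nonneg _))
  obtain ⟨a, ha, hvar⟩ := hg.prox_spec hγ (x - γ • gradient f x)
  rw [hp] at ha hvar
  intro y
  by_cases hy : g y = ⊤
  · rw [hy, EReal.coe_add_top]; exact le_top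
  have hgy : g y = ((g y).toReal : EReal) := (EReal.coe_toReal hy (hg.ne_bot y)).symm
  have h1 := hvar y _ hgy.le
  have h2 := hf.add_inner_gradient_le x y
  rw [sub_sub_cancel_left, inner_neg_left, inner_smul_left, RCLike.conj_to_real, mul_neg,
    inv_mul_cancel_left₀ hγ.ne'] at h1
  rw [ha, hgy, ← EReal.coe_add, ← EReal.coe_add, EReal.coe_le_coe_iff]
  linarith

end ForwardBackwardEnvelope

/-! ### Orthogonality in the conjugate gradient method. -/

section ConjugateGradient

variable {E : Type*} [NormedAddCommGroup E] [InnerProductSpace ℝ E] {A : E →L[ℝ] E} {b : E}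

theorem cgState_succ_iter (A : E →L[ℝ] E) (b : E) (j : ℕ) :
    (cgState A b (j + 1)).iter = (cgState A b j).iter +
      (‖(cgState A b j).res‖ ^ 2 / inner ℝ (cgState A b j).dir (A (cgState A b j).dir)) •
        (cgState A b j).dir := rfl

theorem cgState_succ_res (A : E →L[ℝ] E) (b : E) (j : ℕ) :
    (cgState A b (j + 1)).res = (cgState A b j).res -
      (‖(cgState A b j).res‖ ^ 2 / inner ℝ (cgState A b j).dir (A (cgState A b j).dir)) •
        A (cgState A b j).dir := rfl

theorem cgState_succ_dir (A : E →L[ℝ] E) (b : E) (j : ℕ) :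
    (cgState A b (j + 1)).dir = (cgState A b (j + 1)).res +
      (‖(cgState A b (j + 1)).res‖ ^ 2 / ‖(cgState A b j).res‖ ^ 2) • (cgState A b j).dir := rfl

theorem cgState_res_eq (A : E →L[ℝ] E) (b : E) (j : ℕ) :
    (cgState A b j).res = b - A (cgState A b j).iter := by
  induction j with
  | zero => simp [cgState]
  | succ j ih => rw [cgState_succ_res, cgState_succ_iter, map_add, map_smul, ih]; abel

theorem cgState_dir_eq_zero {j : ℕ} (h : (cgState A b j).res = 0) : (cgState A b j).dir = 0 := by
  cases j with
  | zero => exact h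
  | succ j => rw [cgState_succ_dir, h]; simp

theorem inner_cgState_res_eq_zero {j : ℕ} {w : E}
    (h : ∀ i ≤ j, inner ℝ w (cgState A b i).dir = 0) :
    ∀ i ≤ j, inner ℝ w (cgState A b i).res = 0 := by
  intro i hi
  cases i with
  | zero => exact h 0 hi
  | succ i =>
    have h1 := h (i + 1) hi
    rwa [cgState_succ_dir, inner_add_right, inner_smul_right, h i (by omega), mul_zero,
      add_zero] at h1

/-- Orthogonality relations of the conjugate gradient method: residuals are orthogonal to all
earlier directions, and the directions are conjugate. -/
theorem cgState_orthogonality (hA : ∀ u v, inner ℝ (A u) v = inner ℝ u (A v))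
    (hpos : ∀ u, inner ℝ u (A u) = 0 → u = 0) (j : ℕ) :
    (∀ i < j, inner ℝ (cgState A b j).res (cgState A b i).dir = 0) ∧
    (∀ i < j, inner ℝ (cgState A b j).dir (A (cgState A b i).dir) = 0) ∧
    inner ℝ (cgState A b j).res (cgState A b j).dir = ‖(cgState A b j).res‖ ^ 2 := by
  induction j with
  | zero => exact ⟨by simp, by simp, real_inner_self_eq_norm_sq _⟩
  | succ j ih =>
    obtain ⟨hres, hdir, hdiag⟩ := ih
    have hres' : ∀ i ≤ j, inner ℝ (cgState A b (j + 1)).res (cgState A b i).dir = 0 := by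
      intro i hi
      rw [cgState_succ_res, inner_sub_left, inner_smul_left, RCLike.conj_to_real, hA]
      rcases hi.lt_or_eq with h | rfl
      · rw [hres i h, hdir i h, mul_zero, sub_zero]
      · by_cases hp : (cgState A b i).dir = 0
        · simp [hp]
        · rw [div_mul_cancel₀ _ fun h => hp (hpos _ h), hdiag, sub_self]
    have hrr := inner_cgState_res_eq_zero hres'
    refine ⟨fun i hi => hres' i (Nat.lt_succ_iff.1 hi), fun i hi => ?_, ?_⟩
    · by_cases hp : (cgState A b i).dir = 0
      · simp [hp]
      have hr : (cgState A b i).res ≠ 0 := fun h => hp (cgState_dir_eq_zero h)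
      have hpA : inner ℝ (cgState A b i).dir (A (cgState A b i).dir) ≠ 0 := fun h => hp (hpos _ h)
      have hr2 : ‖(cgState A b i).res‖ ^ 2 ≠ 0 := pow_ne_zero _ (norm_ne_zero_iff.2 hr)
      -- The residual update expresses `A pᵢ` through `rᵢ - rᵢ₊₁`, reducing conjugacy to
      -- orthogonality of residuals; for `i = j` the weight `‖rⱼ₊₁‖² / ‖rⱼ‖²` gives exact
      -- cancellation.
      have hAp : A (cgState A b i).dir =
          (inner ℝ (cgState A b i).dir (A (cgState A b i).dir) / ‖(cgState A b i).res‖ ^ 2) •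
            ((cgState A b i).res - (cgState A b (i + 1)).res) := by
        rw [cgState_succ_res, sub_sub_cancel, smul_smul, div_mul_div_cancel₀ hr2, div_self hpA,
          one_smul]
      rw [cgState_succ_dir, inner_add_left, inner_smul_left, RCLike.conj_to_real]
      rcases (Nat.lt_succ_iff.1 hi).lt_or_eq with h | rfl
      · rw [hdir i h, hAp, inner_smul_right, inner_sub_right, hrr i h.le, hrr (i + 1) h]
        simp
      · rw [show inner ℝ (cgState A b (i + 1)).res (A (cgState A b i).dir) =
          (inner ℝ (cgState A b i).dir (A (cgState A b i).dir) / ‖(cgState A b i).res‖ ^ 2) *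
            (0 - ‖(cgState A b (i + 1)).res‖ ^ 2) by
          conv_lhs => rw [hAp]
          rw [inner_smul_right, inner_sub_right, hrr i le_rfl, real_inner_self_eq_norm_sq]]
        ring
    · rw [cgState_succ_dir, inner_add_right, inner_smul_right, hres' j le_rfl, mul_zero, add_zero,
        real_inner_self_eq_norm_sq]

/-- The residual of a conjugate gradient iterate is orthogonal to the iterate. -/
theorem inner_sub_cgIterate_eq_zero (hA : ∀ u v, inner ℝ (A u) v = inner ℝ u (A v))
    (hpos : ∀ u, inner ℝ u (A u) = 0 → u = 0) (j : ℕ) :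
    inner ℝ (b - A (cgIterate A b j)) (cgIterate A b j) = 0 := by
  -- The iterate is a combination of earlier directions, all orthogonal to the current residual.
  have h : ∀ m ≤ j, inner ℝ (cgState A b j).res (cgState A b m).iter = 0 := by
    intro m hm
    induction m with
    | zero => exact inner_zero_right _
    | succ m ih =>
      rw [cgState_succ_iter, inner_add_right, inner_smul_right, ih (by omega),
        (cgState_orthogonality hA hpos j).1 m hm, mul_zero, add_zero]
  have h' := h j le_rfl
  rwa [cgState_res_eq] at h'

end ConjugateGradient

/-! ### Estimates for the inexact Newton direction. -/

section NewtonCG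

variable {E : Type*} [NormedAddCommGroup E] [InnerProductSpace ℝ E] [FiniteDimensional ℝ E]
  {μ : ℝ} {L : ℝ≥0} {f : E → ℝ} {g : E → EReal} {γ ηbar ζ ρ : ℝ}

/-- Descent, upper and lower bounds for an inexact regularized Newton direction. -/
theorem IsNewtonCGDirection.bounds (hf : SmoothConvexClass μ L f) (hg : ProperLscConvex g)
    (hγ : 0 < γ) (hγL : γ * L < 1) (hζ : 0 < ζ) {x d : E}
    (hd : IsNewtonCGDirection f g γ ηbar ζ ρ x d) (hx : gradient (fbe γ f g) x ≠ 0) :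
    ζ * ‖gradient (fbe γ f g) x‖ * ‖d‖ ^ 2 ≤ -inner ℝ (gradient (fbe γ f g) x) d ∧
    ‖d‖ ≤ ζ⁻¹ ∧
    (1 - ηbar) * ‖gradient (fbe γ f g) x‖ ≤ (2 / γ + ζ * ‖gradient (fbe γ f g) x‖) * ‖d‖ := by
  obtain ⟨H, hH, ⟨j, hj⟩, hres⟩ := hd
  have hHs := inner_symm_of_mem_approxHessian hf hg hγ hH
  have hHp := inner_nonneg_of_mem_approxHessian hf hg hγ hγL hH
  have hHn := norm_le_of_mem_approxHessian hf hg hγ hγL hH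
  set v := gradient (fbe γ f g) x
  have hv : 0 < ‖v‖ := norm_pos_iff.2 hx
  set A : E →L[ℝ] E := H + (ζ * ‖v‖) • (1 : E →L[ℝ] E)
  have hAapp : ∀ u, A u = H u + (ζ * ‖v‖) • u := fun u => rfl
  have hAs : ∀ u w, inner ℝ (A u) w = inner ℝ u (A w) := fun u w => by
    rw [hAapp, hAapp, inner_add_left, inner_add_right, hHs, inner_smul_left, inner_smul_right,
      RCLike.conj_to_real]
  have hAp : ∀ u, ζ * ‖v‖ * ‖u‖ ^ 2 ≤ inner ℝ (A u) u := fun u => by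
    rw [hAapp, inner_add_left, inner_smul_left, RCLike.conj_to_real, real_inner_self_eq_norm_sq]
    linarith [hHp u]
  have hA0 : ∀ u, inner ℝ u (A u) = 0 → u = 0 := fun u hu => by
    have h := hAp u
    rw [hAs, hu] at h
    have := nonpos_of_mul_nonpos_right h (mul_pos hζ hv)
    exact norm_eq_zero.1 (pow_eq_zero_iff two_ne_zero |>.1 (le_antisymm this (sq_nonneg _)))
  have horth := inner_sub_cgIterate_eq_zero (b := -v) hAs hA0 j
  rw [← hj, inner_sub_left, inner_neg_left, sub_eq_zero] at horth
  have hdesc : ζ * ‖v‖ * ‖d‖ ^ 2 ≤ -inner ℝ v d := horth ▸ hAp d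
  refine ⟨hdesc, ?_, ?_⟩
  -- The regularization is proportional to `‖v‖`, so `‖v‖` cancels and the bound `ζ⁻¹` is uniform.
  · have h1 : -inner ℝ v d ≤ ‖v‖ * ‖d‖ := by
      simpa using real_inner_le_norm (-v) d
    rcases (norm_nonneg d).eq_or_lt with h0 | h0
    · rw [← h0]; exact (inv_pos.2 hζ).le
    · have h2 : (‖v‖ * ‖d‖) * (ζ * ‖d‖) ≤ (‖v‖ * ‖d‖) * 1 := by linarith
      have h3 := le_of_mul_le_mul_left h2 (mul_pos hv h0)
      rwa [← le_inv_mul_iff₀ hζ, mul_one] at h3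
  · have h1 : ‖A d + v‖ ≤ ηbar * ‖v‖ := hres.trans (by gcongr; exact min_le_left _ _)
    have h2 : ‖v‖ ≤ ‖A d + v‖ + ‖A d‖ := by
      simpa using norm_sub_le (A d + v) (A d)
    have h3 : ‖A d‖ ≤ (2 / γ + ζ * ‖v‖) * ‖d‖ := by
      rw [hAapp, add_mul]
      refine (norm_add_le _ _).trans (add_le_add (H.le_of_opNorm_le hHn d) ?_)
      rw [norm_smul, Real.norm_of_nonneg (by positivity)]
    linarith

end NewtonCG

/-! ### Convergence of the line search. -/

section Armijo

variable {E : Type*} [NormedAddCommGroup E] [InnerProductSpace ℝ E] [CompleteSpace E]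

/-- Armijo line search along bounded, uniformly gradient-related directions: cluster points are
stationary. -/
theorem gradient_eq_zero_of_armijo {ψ : E → ℝ} {G : E → E} {σ : ℝ} {x d : ℕ → E} {τ : ℕ → ℝ}
    {xbar : E} (hψ : ∀ y, HasGradientAt ψ (G y) y) (hG : Continuous G) (hσ : 0 < σ) (hσ1 : σ < 1)
    (hτ : ∀ k, IsGreatest {t : ℝ | (∃ i : ℕ, t = (1 / 2) ^ i) ∧
      ψ (x k + t • d k) ≤ ψ (x k) + σ * t * inner ℝ (G (x k)) (d k)} (τ k))
    (hx : ∀ k, x (k + 1) = x k + τ k • d k)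
    (hdesc : ∀ k, inner ℝ (G (x k)) (d k) ≤ 0)
    (hdir : ∀ ε R : ℝ, 0 < ε → ∃ M c : ℝ, 0 < M ∧ 0 < c ∧ ∀ k, ε ≤ ‖G (x k)‖ → ‖G (x k)‖ ≤ R →
      ‖d k‖ ≤ M ∧ inner ℝ (G (x k)) (d k) ≤ -c)
    (hxbar : MapClusterPt xbar atTop x) : G xbar = 0 := by
  by_contra hne
  have hpos : 0 < ‖G xbar‖ := norm_pos_iff.2 hne
  obtain ⟨M, c, hM, hc, hbd⟩ := hdir (‖G xbar‖ / 2) (2 * ‖G xbar‖) (by positivity)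
  obtain ⟨φ, hφ, hlim⟩ := hxbar.tendsto_subseq
  have hτpos : ∀ k, 0 < τ k := fun k => by
    obtain ⟨⟨i, hi⟩, -⟩ := (hτ k).1
    rw [hi]; positivity
  have hdec : ∀ k, σ * τ k * -inner ℝ (G (x k)) (d k) ≤ ψ (x k) - ψ (x (k + 1)) := fun k => by
    have := (hτ k).1.2
    rw [hx k]
    linarith
  have hanti : Antitone fun k => ψ (x k) := antitone_nat_of_succ_le fun k => by
    have h1 := mul_nonneg (mul_pos hσ (hτpos k)).le (neg_nonneg.2 (hdesc k))
    linarith [hdec k]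
  have hψc : Continuous ψ := continuous_iff_continuousAt.2 fun y => (hψ y).continuousAt
  -- A monotone sequence with a convergent subsequence converges, so decreases vanish and, as slopes
  -- stay below `-c`, so do the step sizes.
  have hval : Tendsto (fun k => ψ (x k)) atTop (𝓝 (ψ xbar)) :=
    (tendsto_iff_tendsto_subseq_of_antitone hanti hφ.tendsto_atTop).2
      ((hψc.tendsto xbar).comp hlim)
  have hdiff : Tendsto (fun j => ψ (x (φ j)) - ψ (x (φ j + 1))) atTop (𝓝 0) := by
    have h := (hval.sub (hval.comp (tendsto_add_atTop_nat 1))).comp hφ.tendsto_atTop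
    rwa [sub_self] at h
  have hnorm : Tendsto (fun j => ‖G (x (φ j))‖) atTop (𝓝 ‖G xbar‖) :=
    ((hG.tendsto xbar).comp hlim).norm
  have hgood : ∀ᶠ j in atTop, ‖d (φ j)‖ ≤ M ∧ inner ℝ (G (x (φ j))) (d (φ j)) ≤ -c := by
    filter_upwards [hnorm.eventually_const_le (show ‖G xbar‖ / 2 < ‖G xbar‖ by linarith),
      hnorm.eventually_le_const (show ‖G xbar‖ < 2 * ‖G xbar‖ by linarith)] with j h1 h2
    exact hbd _ h1 h2
  have hτlim : ∀ ε : ℝ, 0 < ε → ∀ᶠ j in atTop, τ (φ j) < ε := fun ε hε => by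
    filter_upwards [hgood, hdiff.eventually_lt_const (show 0 < σ * c * ε by positivity)] with j h1 h2
    have h3 := hdec (φ j)
    have h4 : σ * τ (φ j) * c ≤ σ * τ (φ j) * -inner ℝ (G (x (φ j))) (d (φ j)) :=
      mul_le_mul_of_nonneg_left (by linarith [h1.2]) (mul_pos hσ (hτpos _)).le
    have h5 : σ * c * τ (φ j) < σ * c * ε := by linarith
    exact lt_of_mul_lt_mul_left h5 (by positivity)
  -- Chosen so that `2κM = (1 - σ)c`, the slope change needed for a trial step to fail.
  set κ := (1 - σ) * c / (2 * M) with hκ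
  have hκpos : 0 < κ := div_pos (mul_pos (by linarith) hc) (by positivity)
  obtain ⟨r, hr, hball⟩ := Metric.continuousAt_iff.1 (hG.continuousAt (x := xbar)) κ hκpos
  have hnear : ∀ᶠ j in atTop, dist (x (φ j)) xbar < r / 2 :=
    hlim.eventually (Metric.ball_mem_nhds xbar (half_pos hr))
  obtain ⟨j, ⟨hdM, hin⟩, hτ1, hτr, hxr⟩ := (hgood.and ((hτlim 1 one_pos).and
    ((hτlim (r / (4 * M)) (by positivity)).and hnear))).exists
  set y := x (φ j)
  set e := d (φ j)
  set t := τ (φ j)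
  have htpos : 0 < t := hτpos _
  -- As `t < 1`, the doubled step was a legitimate trial, and maximality of `t` means it was
  -- rejected.
  have hfail : ψ y + σ * (2 * t) * inner ℝ (G y) e < ψ (y + (2 * t) • e) := by
    by_contra hcon
    obtain ⟨⟨i, hi⟩, -⟩ := (hτ (φ j)).1
    have hmem : 2 * t ∈ {t : ℝ | (∃ i : ℕ, t = (1 / 2) ^ i) ∧
        ψ (y + t • e) ≤ ψ y + σ * t * inner ℝ (G y) e} := by
      refine ⟨?_, not_lt.1 hcon⟩
      cases i with
      | zero => rw [pow_zero] at hi; exact absurd hi hτ1.ne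
      | succ i => exact ⟨i, by rw [show t = _ from hi, pow_succ]; ring⟩
    have := (hτ (φ j)).2 hmem
    linarith
  have hline := HasGradientAt.hasDerivAt_line hψ y e
  obtain ⟨s, ⟨hs0, hs1⟩, hs⟩ := exists_hasDerivAt_eq_slope (fun s : ℝ => ψ (y + s • e))
    (fun s => inner ℝ (G (y + s • e)) e) (show (0 : ℝ) < 2 * t by positivity)
    (fun s _ => (hline s).continuousAt.continuousWithinAt) (fun s _ => hline s)
  have hslope : σ * inner ℝ (G y) e < inner ℝ (G (y + s • e)) e := by
    rw [hs, sub_zero, lt_div_iff₀ (mul_pos two_pos htpos)]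
    simp only [zero_smul, add_zero]
    linarith
  have hyb : dist (G y) (G xbar) < κ := hball (hxr.trans (half_lt_self hr))
  have hse : dist (y + s • e) xbar < r := by
    have h1 : dist (y + s • e) y ≤ r / 2 := by
      rw [dist_eq_norm, add_sub_cancel_left, norm_smul, Real.norm_of_nonneg hs0.le]
      have hrM : 0 < r / (4 * M) := div_pos hr (by positivity)
      calc s * ‖e‖ ≤ (2 * (r / (4 * M))) * M :=
            mul_le_mul (by linarith) hdM (norm_nonneg _) (by linarith)
        _ = r / 2 := by field_simp; ring
    linarith [dist_triangle (y + s • e) y xbar]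
  have hsb : dist (G (y + s • e)) (G xbar) < κ := hball hse
  have hGd : ‖G (y + s • e) - G y‖ < 2 * κ := by
    rw [← dist_eq_norm]
    linarith [dist_triangle_right (G (y + s • e)) (G y) (G xbar)]
  have hup : inner ℝ (G (y + s • e) - G y) e ≤ 2 * κ * M :=
    (real_inner_le_norm _ _).trans (mul_le_mul hGd.le hdM (norm_nonneg _) (mul_pos two_pos hκpos).le)
  have hκM : 2 * κ * M = (1 - σ) * c := by rw [hκ]; field_simp
  rw [inner_sub_left, hκM] at hup
  have h6 : (1 - σ) * c ≤ (1 - σ) * -inner ℝ (G y) e :=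
    mul_le_mul_of_nonneg_left (by linarith) (by linarith)
  linarith

end Armijo

/-! ### Conclusion for the Newton-CG method. -/

theorem mainTheorem6 (n : ℕ) (f : EuclideanSpace ℝ (Fin n) → ℝ)
    (g : EuclideanSpace ℝ (Fin n) → EReal) (μ : ℝ) (L : ℝ≥0)
    (hf : SmoothConvexClass μ L f) (hg : ProperLscConvex g)
    (γ σ ηbar ζ ρ : ℝ) (hγ : 0 < γ) (hγL : γ * L < 1) (hσ : σ ∈ Set.Ioo (0 : ℝ) (1 / 2))
    (hη : ηbar ∈ Set.Ioo (0 : ℝ) 1) (hζ : ζ ∈ Set.Ioo (0 : ℝ) 1) (hρ : ρ ∈ Set.Ioc (0 : ℝ) 1)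
    (x : ℕ → EuclideanSpace ℝ (Fin n)) (hx : IsFBNCGSequence f g γ σ ηbar ζ ρ x)
    (xbar : EuclideanSpace ℝ (Fin n)) (hxbar : MapClusterPt xbar atTop x) :
    xbar ∈ solutionSet f g := by
  choose d τ hd hτ hstep using hx
  have hζ0 : 0 < ζ := hζ.1
  have hη1 : 0 < 1 - ηbar := sub_pos.2 hη.2
  refine mem_solutionSet_of_gradient_fbe_eq_zero hf hg hγ hγL
    (gradient_eq_zero_of_armijo (ψ := fbe γ f g) (d := d) (τ := τ)
      (fun y => (hasGradientAt_fbe hf hg hγ y).differentiableAt.hasGradientAt)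
      (continuous_fbe_gradient hf hg hγ) hσ.1 (by linarith [hσ.2]) hτ hstep (fun k => ?_)
      (fun ε R hε => ?_) hxbar)
  · by_cases h0 : gradient (fbe γ f g) (x k) = 0
    · rw [h0, inner_zero_left]
    · have h1 := ((hd k).bounds hf hg hγ hγL hζ0 h0).1
      have h2 : 0 ≤ ζ * ‖gradient (fbe γ f g) (x k)‖ * ‖d k‖ ^ 2 := by positivity
      linarith
  -- The residual test keeps `‖d k‖` at least `m`; `|R|` keeps the denominator positive for every
  -- real `R`.
  · set m := (1 - ηbar) * ε / (2 / γ + ζ * |R|) with hm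
    have hden : 0 < 2 / γ + ζ * |R| := by positivity
    have hmpos : 0 < m := div_pos (mul_pos hη1 hε) hden
    refine ⟨ζ⁻¹, ζ * ε * m ^ 2, inv_pos.2 hζ0, by positivity, fun k hk hkR => ?_⟩
    have h0 : gradient (fbe γ f g) (x k) ≠ 0 := norm_pos_iff.1 (hε.trans_le hk)
    obtain ⟨h1, h2, h3⟩ := (hd k).bounds hf hg hγ hγL hζ0 h0
    refine ⟨h2, ?_⟩
    have h4 : m ≤ ‖d k‖ := by
      rw [hm, div_le_iff₀' hden]
      calc (1 - ηbar) * ε ≤ (1 - ηbar) * ‖gradient (fbe γ f g) (x k)‖ := by gcongr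
        _ ≤ (2 / γ + ζ * ‖gradient (fbe γ f g) (x k)‖) * ‖d k‖ := h3
        _ ≤ (2 / γ + ζ * |R|) * ‖d k‖ := by
          gcongr
          exact hkR.trans (le_abs_self R)
    have h5 : ζ * ε * m ^ 2 ≤ ζ * ‖gradient (fbe γ f g) (x k)‖ * ‖d k‖ ^ 2 := by gcongr
    linarith
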